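/- For $n\ge 0$ and $p\in(0,1)$ let $\mu_p$ be the product measure on $\{0,1\}^n$ in which each coordinate equals $1$ with probability $p$, and for $0\le k\le n$ let $\nu_k$ be the uniform measure on the slice $\{x\in\{0,1\}^n : x_1+\dots+x_n=k\}$. Write $\|f\|_\alpha=\sqrt{\mathbb E_\alpha[f^2]}$. A polynomial in $\mathbb R[x_1,\dots,x_n]$ is multilinear if all its monomials are squarefree, and harmonic if $\sum_{i=1}^n \partial f/\partial x_i=0$. For $0<\eta\le 1$ and $M\ge 1$, integers $k_1,\dots,k_r\in\{0,\dots,n\}$ form an $(\eta,M)$-system (with respect to $n$ and $p$) if the numbers $\sigma_i=\frac{k_i-np}{\sqrt{np(1-p)}}$ satisfy $|\sigma_i-\sigma_j|\ge\eta$ for all $i\ne j$ and $|\sigma_i|\le M$ for all $i$. Theorem. There are absolute constants $C>0$ and $B\in\mathbb N$ such that the following holds. Let $p\in(0,1)$, let $n,d\ge 0$ be integers with $d\le\sqrt{np(1-p)}$, and let $f$ be a real multilinear polynomial over $x_1,\dots,x_n$ of degree at most $d$. Let $k_1,\dots,k_{d+1}$ be an $(\eta,M)$-system with $M\le\frac12\sqrt{np(1-p)}$,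 and suppose that $\|f\|_{\nu_{k_i}}\le 1$ for all $1\le i\le d+1$. Then \[ \|f\|_{\mu_p}\le\left(C\cdot\frac{d}{p(1-p)}\cdot\frac{M}{\eta}\right)^{Bd} \] (where $0^0=1$). Moreover, there are unique harmonic multilinear polynomials $f_0,\dots,f_d$ over $x_1,\dots,x_n$, with $\deg f_e\le d-e$, such that \[ f(x)=\sum_{e=0}^d f_e(x)\left(\frac{x_1+\dots+x_n-np}{\sqrt{np(1-p)}}\right)^e \quad\text{for all } x\in\{0,1\}^n \] (the Blekherman coefficients of $f$ with respect to $p$), and they satisfy $\|f_e\|_{\mu_p}\le (C\,M/\eta)^d$ for all $0\le e\le d$. -/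

import Mathlib

open MvPolynomial

noncomputable section

namespace SliceCube

/-- The point of `{0,1}ⁿ ⊆ ℝⁿ` encoded by a Boolean vector. -/
def point {n : ℕ} (x : Fin n → Bool) : Fin n → ℝ := fun i => if x i then 1 else 0

/-- The slice: all points of the Boolean cube with exactly `k` coordinates equal to `1`. -/
def slice (n k : ℕ) : Finset (Fin n → Bool) :=
  Finset.univ.filter fun x => (Finset.univ.filter fun i => x i = true).card = k

/-- The mass that the product measure `μ_p` gives to a point of the Boolean cube. -/
def cubeMass {n : ℕ} (p : ℝ) (x : Fin n → Bool) : ℝ := ∏ i, if x i then p else 1 - p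

/-- The `L₂` norm of `f` with respect to the product measure `μ_p` on the Boolean cube. -/
def cubeNorm {n : ℕ} (p : ℝ) (f : MvPolynomial (Fin n) ℝ) : ℝ :=
  Real.sqrt (∑ x : Fin n → Bool, cubeMass p x * (eval (point x) f) ^ 2)

/-- The `L₂` norm of `f` with respect to the uniform measure `ν_k` on the `k`-th slice
(meant for `k ≤ n`, when the slice is not empty). -/
def sliceNorm {n : ℕ} (k : ℕ) (f : MvPolynomial (Fin n) ℝ) : ℝ :=
  Real.sqrt ((∑ x ∈ slice n k, (eval (point x) f) ^ 2) / ((slice n k).card : ℝ))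

/-- Every monomial of `f` is squarefree. -/
def IsMultilinear {n : ℕ} (f : MvPolynomial (Fin n) ℝ) : Prop :=
  ∀ m ∈ f.support, ∀ i, m i ≤ 1

/-- `f` is annihilated by the sum of all the partial derivatives. -/
def IsHarmonic {n : ℕ} (f : MvPolynomial (Fin n) ℝ) : Prop :=
  ∑ i, pderiv i f = 0

/-- The standardization `(s - np) / √(np(1-p))`. -/
def standardize (n : ℕ) (p s : ℝ) : ℝ := (s - n * p) / Real.sqrt (n * p * (1 - p))

/-- `F 0, …, F d` are the coefficients of a Blekherman expansion of `f` with respect to `p`: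
`F e` is a harmonic multilinear polynomial of degree at most `d - e`, and `f` agrees on the Boolean
cube with `∑ e, F e * 𝒮 ^ e`, where `𝒮` is the standardization of `x₁ + ⋯ + xₙ`. -/
structure IsBlekhermanExpansion {n : ℕ} (p : ℝ) (d : ℕ) (f : MvPolynomial (Fin n) ℝ)
    (F : Fin (d + 1) → MvPolynomial (Fin n) ℝ) : Prop where
  multilinear : ∀ e, IsMultilinear (F e)
  harmonic : ∀ e, IsHarmonic (F e)
  degree_le : ∀ e, (F e).totalDegree ≤ d - (e : ℕ)
  expansion : ∀ x : Fin n → Bool,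
    eval (point x) f = ∑ e, eval (point x) (F e) * standardize n p (∑ i, point x i) ^ (e : ℕ)

/-- `k` is an `(η, M)`-system with respect to `n` and `p`. -/
structure IsSystem (n : ℕ) (p η M : ℝ) {r : ℕ} (k : Fin r → ℕ) : Prop where
  eta_pos : 0 < η
  eta_le_one : η ≤ 1
  one_le_M : 1 ≤ M
  le_n : ∀ i, k i ≤ n
  separated : ∀ i j, i ≠ j → η ≤ |standardize n p (k i) - standardize n p (k j)|
  bounded : ∀ i, |standardize n p (k i)| ≤ M

end SliceCube

end

namespace SliceCube

/-- The square of the `L₂` norm with respect to `μ_p`. -/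
noncomputable def cubeSq {n : ℕ} (p : ℝ) (f : MvPolynomial (Fin n) ℝ) : ℝ :=
  ∑ x : Fin n → Bool, cubeMass p x * (eval (point x) f) ^ 2

/-- The sum of the squares of the values of a polynomial on a slice. -/
noncomputable def sliceSum {n : ℕ} (k : ℕ) (f : MvPolynomial (Fin n) ℝ) : ℝ :=
  ∑ x ∈ slice n k, (eval (point x) f) ^ 2

variable {n : ℕ}

theorem IsMultilinear.eval_eq {g : MvPolynomial (Fin n) ℝ} (hg : IsMultilinear g)
    (y : Fin n → ℝ) :
    eval y g = ∑ m ∈ g.support, g.coeff m * ∏ i ∈ m.support, y i := by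
  rw [MvPolynomial.eval_eq]
  refine Finset.sum_congr rfl fun m hm => ?_
  congr 1
  refine Finset.prod_congr rfl fun i hi => ?_
  have h1 := hg m hm i
  have h2 : m i ≠ 0 := Finsupp.mem_support_iff.1 hi
  rw [show m i = 1 by omega, pow_one]

theorem IsMultilinear.support_injOn {g : MvPolynomial (Fin n) ℝ} (hg : IsMultilinear g)
    {m m' : Fin n →₀ ℕ} (hm : m ∈ g.support) (hm' : m' ∈ g.support)
    (h : m.support = m'.support) : m = m' := by
  ext i
  have h1 := hg m hm i
  have h2 := hg m' hm' i
  have h3 : m i ≠ 0 ↔ m' i ≠ 0 := by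
    rw [← Finsupp.mem_support_iff, ← Finsupp.mem_support_iff, h]
  omega

theorem card_support_le_totalDegree {g : MvPolynomial (Fin n) ℝ}
    {m : Fin n →₀ ℕ} (hm : m ∈ g.support) : m.support.card ≤ g.totalDegree := by
  refine le_trans ?_ (le_totalDegree hm)
  rw [Finset.card_eq_sum_ones, Finsupp.sum]
  refine Finset.sum_le_sum fun i hi => ?_
  have := Finsupp.mem_support_iff.1 hi
  omega

theorem IsHarmonic.eval_add {g : MvPolynomial (Fin n) ℝ} (hg : IsHarmonic g)
    (y : Fin n → ℝ) (c : ℝ) : eval (fun i => y i + c) g = eval y g := by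
  let φ : MvPolynomial (Fin n) ℝ →ₐ[ℝ] Polynomial ℝ :=
    aeval fun i => Polynomial.C (y i) + Polynomial.X
  have key : ∀ f : MvPolynomial (Fin n) ℝ,
      Polynomial.derivative (φ f) = φ (∑ i, pderiv i f) := by
    intro f
    induction f using MvPolynomial.induction_on with
    | C a => simp [φ]
    | add f g hf hg =>
      simp only [map_add, Finset.sum_add_distrib, hf, hg]
    | mul_X f j hf =>
      simp only [map_mul, Polynomial.derivative_mul, hf, pderiv_mul, Finset.sum_add_distrib,
        map_add, ← Finset.sum_mul, pderiv_X]
      simp [φ, Pi.single_apply]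
  have h0 : Polynomial.derivative (φ g) = 0 := by
    rw [key, hg, map_zero]
  have h1 := Polynomial.eq_C_of_natDegree_eq_zero
    (Polynomial.derivative_eq_zero.1 h0)
  have h2 : ∀ t : ℝ, (φ g).eval t = eval (fun i => y i + t) g := by
    intro t
    have : (Polynomial.evalRingHom t).comp (φ : MvPolynomial (Fin n) ℝ →+* Polynomial ℝ)
        = eval (fun i => y i + t) := by
      ext i <;> simp [φ]
    rw [← this]; rfl
  have h3 := h2 0
  rw [← h2 c, h1, Polynomial.eval_C]
  rw [h1, Polynomial.eval_C] at h3
  simpa using h3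

theorem sum_cubeMass_mul_prod (p : ℝ) (A B : Finset (Fin n)) :
    ∑ x : Fin n → Bool, cubeMass p x *
      ((∏ i ∈ A, (point x i - p)) * ∏ i ∈ B, (point x i - p)) =
      if A = B then (p * (1 - p)) ^ A.card else 0 := by
  have h1 : ∀ x : Fin n → Bool, cubeMass p x *
      ((∏ i ∈ A, (point x i - p)) * ∏ i ∈ B, (point x i - p)) =
      ∏ i, (fun (i : Fin n) (b : Bool) => (if b then p else 1 - p) *
        ((if i ∈ A then (if b then 1 else 0) - p else 1) *
          (if i ∈ B then (if b then 1 else 0) - p else 1))) i (x i) := by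
    intro x
    simp only [Finset.prod_mul_distrib, Finset.prod_ite_mem, Finset.univ_inter, cubeMass, point]
  rw [Finset.sum_congr rfl fun x _ => h1 x]
  refine (Fintype.prod_sum (ι := Fin n) (κ := fun _ => Bool) (fun (i : Fin n) (b : Bool) =>
    (if b then p else 1 - p) * ((if i ∈ A then (if b then 1 else 0) - p else 1) *
      (if i ∈ B then (if b then 1 else 0) - p else 1)))).symm.trans ?_
  have h2 : ∀ i : Fin n, (∑ b : Bool, (if b then p else 1 - p) *
        ((if i ∈ A then (if b then 1 else 0) - p else 1) *
          (if i ∈ B then (if b then 1 else 0) - p else 1))) =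
      if i ∈ A ↔ i ∈ B then (if i ∈ A then p * (1 - p) else 1) else 0 := by
    intro i
    by_cases hA : i ∈ A <;> by_cases hB : i ∈ B <;> simp [hA, hB] <;> ring
  rw [Finset.prod_congr rfl fun i _ => h2 i]
  split_ifs with hAB
  · subst hAB
    simp [Finset.prod_ite_mem]
  · have : ∃ i, ¬ (i ∈ A ↔ i ∈ B) := by
      by_contra! h
      exact hAB (Finset.ext h)
    obtain ⟨i, hi⟩ := this
    exact Finset.prod_eq_zero (Finset.mem_univ i) (if_neg hi)

theorem cubeSq_eq_sum_coeff {g : MvPolynomial (Fin n) ℝ} (hg : IsMultilinear g)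
    (hh : IsHarmonic g) (p : ℝ) :
    cubeSq p g = ∑ m ∈ g.support, g.coeff m ^ 2 * (p * (1 - p)) ^ m.support.card := by
  have h1 : ∀ x : Fin n → Bool, eval (point x) g =
      ∑ m ∈ g.support, g.coeff m * ∏ i ∈ m.support, (point x i - p) := by
    intro x
    rw [← hh.eval_add (point x) (-p), hg.eval_eq]
    simp only [sub_eq_add_neg]
  have h2 : ∀ x : Fin n → Bool, cubeMass p x * (eval (point x) g) ^ 2 =
      ∑ m ∈ g.support, ∑ m' ∈ g.support, g.coeff m * g.coeff m' * (cubeMass p x *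
        ((∏ i ∈ m.support, (point x i - p)) * ∏ i ∈ m'.support, (point x i - p))) := by
    intro x
    rw [h1, sq, Finset.sum_mul_sum, Finset.mul_sum]
    refine Finset.sum_congr rfl fun m _ => ?_
    rw [Finset.mul_sum]
    refine Finset.sum_congr rfl fun m' _ => ?_
    ring
  simp only [cubeSq, h2]
  rw [Finset.sum_comm]
  refine Finset.sum_congr rfl fun m hm => ?_
  rw [Finset.sum_comm]
  simp_rw [← Finset.mul_sum, sum_cubeMass_mul_prod]
  rw [Finset.sum_eq_single m]
  · simp [sq]
  · intro m' hm' hne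
    rw [if_neg fun h => hne (hg.support_injOn hm hm' h).symm, mul_zero]
  · exact fun h => absurd hm h

theorem cubeMass_of_mem_slice {k : ℕ} (p : ℝ) {x : Fin n → Bool} (hx : x ∈ slice n k) :
    cubeMass p x = p ^ k * (1 - p) ^ (n - k) := by
  have hx' : (Finset.univ.filter fun i => x i = true).card = k := by simpa [slice] using hx
  have h2 : (Finset.univ.filter fun i => ¬ x i = true).card = n - k := by
    have := Finset.card_filter_add_card_filter_not (s := Finset.univ) (fun i => x i = true)
    rw [Finset.card_univ, Fintype.card_fin] at this
    omega
  rw [cubeMass, Finset.prod_ite, Finset.prod_const, Finset.prod_const, hx', h2]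

theorem sum_point_of_mem_slice {k : ℕ} {x : Fin n → Bool} (hx : x ∈ slice n k) :
    ∑ i, point x i = k := by
  have hx' : (Finset.univ.filter fun i => x i = true).card = k := by simpa [slice] using hx
  simp [point, hx']

theorem card_slice (n k : ℕ) : (slice n k).card = n.choose k := by
  rw [show n.choose k = ((Finset.univ : Finset (Fin n)).powersetCard k).card by simp]
  refine Finset.card_bij' (fun x _ => Finset.univ.filter fun i => x i = true)
    (fun s _ i => decide (i ∈ s)) ?_ ?_ ?_ ?_
  · intro x hx
    simpa [slice, Finset.mem_powersetCard] using hx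
  · intro s hs
    simpa [slice, Finset.mem_powersetCard] using hs
  · intro x hx
    ext i; simp
  · intro s hs
    ext i; simp

theorem sum_eq_sum_slice (F : (Fin n → Bool) → ℝ) :
    ∑ x, F x = ∑ k ∈ Finset.range (n + 1), ∑ x ∈ slice n k, F x := by
  unfold slice
  rw [Finset.sum_fiberwise_of_maps_to]
  intro x _
  have := Finset.card_filter_le (Finset.univ : Finset (Fin n)) (fun i => x i = true)
  rw [Finset.card_univ, Fintype.card_fin] at this
  simp; omega

theorem sum_cubeMass_mul (p : ℝ) (F : (Fin n → Bool) → ℝ) :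
    ∑ x, cubeMass p x * F x =
      ∑ k ∈ Finset.range (n + 1), p ^ k * (1 - p) ^ (n - k) * ∑ x ∈ slice n k, F x := by
  rw [sum_eq_sum_slice]
  refine Finset.sum_congr rfl fun k _ => ?_
  rw [Finset.mul_sum]
  exact Finset.sum_congr rfl fun x hx => by rw [cubeMass_of_mem_slice p hx]

theorem sliceSum_eq_sum_coeff {g : MvPolynomial (Fin n) ℝ} (hg : IsMultilinear g)
    (hh : IsHarmonic g) {d : ℕ} (hd : g.totalDegree ≤ d) (hn : 2 * d ≤ n) {k : ℕ} (hk : k ≤ n) :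
    sliceSum k g = ∑ m ∈ g.support, g.coeff m ^ 2 *
      (if m.support.card ≤ k then
        ((n - 2 * m.support.card).choose (k - m.support.card) : ℝ) else 0) := by
  have key : (∑ k ∈ Finset.range (n + 1), Polynomial.C (sliceSum k g) * (Polynomial.X : Polynomial ℝ) ^ k) =
      ∑ m ∈ g.support, Polynomial.C (g.coeff m ^ 2) *
        ((1 + Polynomial.X) ^ (n - 2 * m.support.card) * Polynomial.X ^ m.support.card) := by
    refine Polynomial.eq_of_infinite_eval_eq _ _ ((Set.Ioi_infinite (0 : ℝ)).mono ?_)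
    intro z hz
    have hz0 : (0 : ℝ) < z := hz
    have hz1 : (1 + z) ≠ 0 := by positivity
    have h1 := cubeSq_eq_sum_coeff hg hh (z / (1 + z))
    rw [cubeSq, sum_cubeMass_mul] at h1
    have hq : 1 - z / (1 + z) = 1 / (1 + z) := by field_simp; ring
    rw [hq] at h1
    have h2 := congrArg (fun t => (1 + z) ^ n * t) h1
    simp only [Finset.mul_sum] at h2
    simp only [Set.mem_ofPred_eq, Polynomial.eval_finsetSum, Polynomial.eval_mul,
      Polynomial.eval_pow, Polynomial.eval_C, Polynomial.eval_X, Polynomial.eval_add]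
    calc _ = _ := ?_
      _ = _ := h2
      _ = _ := ?_
    · refine Finset.sum_congr rfl fun k hk => ?_
      have hk : k ≤ n := by simpa [Nat.lt_succ_iff] using hk
      rw [sliceSum, Finset.sum_mul]
      refine Finset.sum_congr rfl fun x _ => ?_
      obtain ⟨j, rfl⟩ := Nat.exists_eq_add_of_le hk
      rw [Nat.add_sub_cancel_left, pow_add, div_pow, div_pow]
      field_simp
      simp
    · refine Finset.sum_congr rfl fun m hm => ?_
      have hm2 : 2 * m.support.card ≤ n := by
        have := card_support_le_totalDegree hm
        omega
      have hpow : (1 + z) ^ n = (1 + z) ^ (2 * m.support.card) *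
          (1 + z) ^ (n - 2 * m.support.card) := by
        rw [← pow_add, Nat.add_sub_cancel' hm2]
      rw [hpow, mul_pow, div_pow, div_pow, pow_mul', sq ((1 + z) ^ _)]
      field_simp
      simp [mul_comm]
  have hl : (∑ k ∈ Finset.range (n + 1), Polynomial.C (sliceSum k g) *
      (Polynomial.X : Polynomial ℝ) ^ k).coeff k = sliceSum k g := by
    simp only [Polynomial.finsetSum_coeff, Polynomial.coeff_C_mul_X_pow]
    rw [Finset.sum_ite_eq, if_pos (by simp; omega)]
  rw [← hl, key]
  simp only [Polynomial.finsetSum_coeff, Polynomial.coeff_C_mul,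
    Polynomial.coeff_mul_X_pow', Polynomial.coeff_one_add_X_pow]

theorem choose_le_choose_add_two (m j : ℕ) : m.choose j ≤ (m + 2).choose (j + 1) := by
  rw [Nat.choose_succ_succ, Nat.choose_succ_succ m j]
  omega

theorem choose_sub_le_choose {n k t : ℕ} (hk : t ≤ k) (hn : 2 * t ≤ n) :
    (n - 2 * t).choose (k - t) ≤ n.choose k := by
  induction t with
  | zero => simp
  | succ t ih =>
    refine le_trans ?_ (ih (by omega) (by omega))
    have := choose_le_choose_add_two (n - 2 * (t + 1)) (k - (t + 1))
    rwa [show n - 2 * (t + 1) + 2 = n - 2 * t by omega,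
      show k - (t + 1) + 1 = k - t by omega] at this

theorem choose_add_two_mul (m j : ℕ) :
    (m + 2).choose (j + 1) * ((j + 1) * (m + 1 - j)) = (m + 2) * (m + 1) * m.choose j := by
  have h1 := Nat.add_one_mul_choose_eq (m + 1) j
  have h2 := Nat.choose_mul_succ_eq m j
  calc (m + 2).choose (j + 1) * ((j + 1) * (m + 1 - j))
      = ((m + 1 + 1).choose (j + 1) * (j + 1)) * (m + 1 - j) := by ring
    _ = (m + 2) * ((m + 1).choose j * (m + 1 - j)) := by rw [← h1]; ring
    _ = _ := by rw [← h2]; ring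

/-- Bounds on a slice index that is at distance at most half a variance from the mean. -/
structure IsCentral (n d : ℕ) (p : ℝ) (k : ℕ) : Prop where
  le_n : k ≤ n
  lower : ∀ t : ℕ, t < d → n * p / 4 ≤ (k : ℝ) - t
  upper : ∀ t : ℕ, t < d → n * (1 - p) / 4 ≤ (n : ℝ) - k - t

theorem IsCentral.le_k {n d : ℕ} {p : ℝ} {k : ℕ} (h : IsCentral n d p k) (hp : 0 < p)
    (hn : 0 < n) : d ≤ k := by
  rcases Nat.eq_zero_or_pos d with rfl | hd
  · exact Nat.zero_le _
  · have h1 := h.lower (d - 1) (by omega)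
    have h2 : (0 : ℝ) < n * p / 4 := by positivity
    have h3 : ((d - 1 : ℕ) : ℝ) < k := by linarith
    have := Nat.cast_lt.1 h3
    omega

theorem IsCentral.add_le {n d : ℕ} {p : ℝ} {k : ℕ} (h : IsCentral n d p k) (hp : p < 1)
    (hn : 0 < n) : k + d ≤ n := by
  rcases Nat.eq_zero_or_pos d with rfl | hd
  · simpa using h.le_n
  · have h1 := h.upper (d - 1) (by omega)
    have h2 : (0 : ℝ) < n * (1 - p) / 4 := by
      have : 0 < 1 - p := by linarith
      positivity
    have h3 : ((k + (d - 1) : ℕ) : ℝ) < n := by push_cast; linarith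
    have := Nat.cast_lt.1 h3
    omega

theorem IsCentral.pow_mul_choose_le {n d : ℕ} {p : ℝ} {k : ℕ} (h : IsCentral n d p k)
    (hp : 0 < p) (hp1 : p < 1) (hn : 0 < n) {t : ℕ} (ht : t ≤ d) :
    (p * (1 - p)) ^ t * (n.choose k : ℝ) ≤ 16 ^ t * ((n - 2 * t).choose (k - t) : ℝ) := by
  have hk := h.le_k hp hn
  have hk' := h.add_le hp1 hn
  have hq : 0 < 1 - p := by linarith
  induction t with
  | zero => simp
  | succ t ih =>
    have ih := ih (by omega)
    obtain ⟨j, hj⟩ : ∃ j, k = j + 1 + t := ⟨k - 1 - t, by omega⟩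
    obtain ⟨m, hm⟩ : ∃ m, n = m + 2 + 2 * t := ⟨n - 2 - 2 * t, by omega⟩
    have hjm : j ≤ m := by omega
    have e1 : n - 2 * t = m + 2 := by omega
    have e2 : n - 2 * (t + 1) = m := by omega
    have e3 : k - t = j + 1 := by omega
    have e4 : k - (t + 1) = j := by omega
    rw [e1, e3] at ih
    rw [e2, e4]
    have h1 : ((m + 2).choose (j + 1) : ℝ) * (((j : ℝ) + 1) * ((m : ℝ) + 1 - j)) =
        ((m : ℝ) + 2) * ((m : ℝ) + 1) * (m.choose j : ℝ) := by
      have := choose_add_two_mul m j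
      have := congrArg (Nat.cast (R := ℝ)) this
      push_cast [Nat.cast_sub (show j ≤ m + 1 by omega)] at this
      exact this
    have hnr : (n : ℝ) = m + 2 + 2 * t := by rw [hm]; push_cast; ring
    have hkr : (k : ℝ) = j + 1 + t := by rw [hj]; push_cast; ring
    have hl := h.lower t (by omega)
    have hu := h.upper t (by omega)
    have h2 : (n : ℝ) ^ 2 * (p * (1 - p)) ≤ 16 * (((j : ℝ) + 1) * ((m : ℝ) + 1 - j)) := by
      have a1 : n * p / 4 ≤ (j : ℝ) + 1 := by linarith
      have a2 : n * (1 - p) / 4 ≤ (m : ℝ) + 1 - j := by linarith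
      have := mul_le_mul a1 a2 (by positivity) (by positivity)
      linarith
    have h3 : ((m : ℝ) + 2) * ((m : ℝ) + 1) ≤ (n : ℝ) ^ 2 := by
      rw [hnr, sq]
      have : (0 : ℝ) ≤ t := Nat.cast_nonneg t
      apply mul_le_mul <;> first | positivity | linarith
    have h4 : p * (1 - p) * ((m + 2).choose (j + 1) : ℝ) ≤ 16 * (m.choose j : ℝ) := by
      have hn2 : (0 : ℝ) < (n : ℝ) ^ 2 := by positivity
      refine le_of_mul_le_mul_left ?_ hn2
      calc (n : ℝ) ^ 2 * (p * (1 - p) * ((m + 2).choose (j + 1) : ℝ))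
          = (n : ℝ) ^ 2 * (p * (1 - p)) * ((m + 2).choose (j + 1) : ℝ) := by ring
        _ ≤ 16 * (((j : ℝ) + 1) * ((m : ℝ) + 1 - j)) * ((m + 2).choose (j + 1) : ℝ) := by gcongr
        _ = 16 * (((m + 2).choose (j + 1) : ℝ) * (((j : ℝ) + 1) * ((m : ℝ) + 1 - j))) := by ring
        _ = 16 * (((m : ℝ) + 2) * ((m : ℝ) + 1) * (m.choose j : ℝ)) := by rw [h1]
        _ ≤ 16 * ((n : ℝ) ^ 2 * (m.choose j : ℝ)) := by gcongr
        _ = _ := by ring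
    calc (p * (1 - p)) ^ (t + 1) * (n.choose k : ℝ)
        = p * (1 - p) * ((p * (1 - p)) ^ t * (n.choose k : ℝ)) := by ring
      _ ≤ p * (1 - p) * (16 ^ t * ((m + 2).choose (j + 1) : ℝ)) := by gcongr
      _ = 16 ^ t * (p * (1 - p) * ((m + 2).choose (j + 1) : ℝ)) := by ring
      _ ≤ 16 ^ t * (16 * (m.choose j : ℝ)) := by gcongr
      _ = _ := by ring

theorem IsCentral.of_standardize {n d : ℕ} {p : ℝ} {k : ℕ} (hp : 0 < p) (hp1 : p < 1)
    (hd : (d : ℝ) ≤ Real.sqrt (n * p * (1 - p))) (hs : 2 ≤ Real.sqrt (n * p * (1 - p)))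
    (hk : k ≤ n) (h : |standardize n p k| ≤ Real.sqrt (n * p * (1 - p)) / 2) :
    IsCentral n d p k := by
  have hq : 0 < 1 - p := by linarith
  set s := Real.sqrt (n * p * (1 - p)) with hs_def
  have hs0 : 0 < s := by linarith
  have hsq : s ^ 2 = n * p * (1 - p) := Real.sq_sqrt (by positivity)
  have h1 : |(k : ℝ) - n * p| ≤ s ^ 2 / 2 := by
    rw [standardize, abs_div, abs_of_pos hs0, div_le_iff₀ hs0] at h
    linarith
  have h2 := abs_le.1 h1
  have hle1 : s ^ 2 ≤ n * p := by
    rw [hsq]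
    have : (0 : ℝ) ≤ n * p := by positivity
    nlinarith
  have hle2 : s ^ 2 ≤ n * (1 - p) := by
    rw [hsq]
    have : (0 : ℝ) ≤ n * (1 - p) := by positivity
    nlinarith
  have h3 : s - 1 ≤ s ^ 2 / 4 := by nlinarith [sq_nonneg (s - 2)]
  refine ⟨hk, fun t ht => ?_, fun t ht => ?_⟩
  · have : (t : ℝ) + 1 ≤ d := by exact_mod_cast ht
    linarith
  · have : (t : ℝ) + 1 ≤ d := by exact_mod_cast ht
    linarith

theorem cubeSq_le_of_isCentral {g : MvPolynomial (Fin n) ℝ} (hg : IsMultilinear g)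
    (hh : IsHarmonic g) {d : ℕ} (hd : g.totalDegree ≤ d) {p : ℝ} (hp : 0 < p) (hp1 : p < 1)
    (hn : 0 < n) {k : ℕ} (hk : IsCentral n d p k) :
    cubeSq p g ≤ 16 ^ d * (sliceSum k g / (n.choose k : ℝ)) := by
  have h1 := hk.le_k hp hn
  have h2 := hk.add_le hp1 hn
  have hc : (0 : ℝ) < n.choose k := by exact_mod_cast Nat.choose_pos hk.le_n
  rw [← mul_div_assoc, le_div_iff₀ hc, cubeSq_eq_sum_coeff hg hh,
    sliceSum_eq_sum_coeff hg hh hd (by omega) hk.le_n, Finset.sum_mul, Finset.mul_sum]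
  refine Finset.sum_le_sum fun m hm => ?_
  have hm' : m.support.card ≤ d := (card_support_le_totalDegree hm).trans hd
  rw [if_pos (hm'.trans h1)]
  have h3 := hk.pow_mul_choose_le hp hp1 hn hm'
  calc g.coeff m ^ 2 * (p * (1 - p)) ^ m.support.card * (n.choose k : ℝ)
      = g.coeff m ^ 2 * ((p * (1 - p)) ^ m.support.card * (n.choose k : ℝ)) := by ring
    _ ≤ g.coeff m ^ 2 * (16 ^ m.support.card *
        ((n - 2 * m.support.card).choose (k - m.support.card) : ℝ)) := by gcongr
    _ ≤ g.coeff m ^ 2 * (16 ^ d *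
        ((n - 2 * m.support.card).choose (k - m.support.card) : ℝ)) := by
        gcongr
        norm_num
    _ = _ := by ring

theorem sliceSum_le_cubeSq {g : MvPolynomial (Fin n) ℝ} (hg : IsMultilinear g)
    (hh : IsHarmonic g) {d : ℕ} (hd : g.totalDegree ≤ d) (hn : 2 * d ≤ n)
    {p : ℝ} (hp : 0 < p) (hp1 : p < 1) {k : ℕ} (hk : k ≤ n) :
    (p * (1 - p)) ^ d * sliceSum k g ≤ n.choose k * cubeSq p g := by
  have hq : 0 < 1 - p := by linarith
  have hpq : p * (1 - p) ≤ 1 := by nlinarith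
  rw [cubeSq_eq_sum_coeff hg hh, sliceSum_eq_sum_coeff hg hh hd hn hk, Finset.mul_sum,
    Finset.mul_sum]
  refine Finset.sum_le_sum fun m hm => ?_
  have hm' : m.support.card ≤ d := (card_support_le_totalDegree hm).trans hd
  split_ifs with hmk
  · have h1 : ((n - 2 * m.support.card).choose (k - m.support.card) : ℝ) ≤ n.choose k := by
      exact_mod_cast choose_sub_le_choose hmk (by omega)
    have h2 : (p * (1 - p)) ^ d ≤ (p * (1 - p)) ^ m.support.card :=
      pow_le_pow_of_le_one (by positivity) hpq hm'
    calc (p * (1 - p)) ^ d * (g.coeff m ^ 2 *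
          ((n - 2 * m.support.card).choose (k - m.support.card) : ℝ))
        ≤ (p * (1 - p)) ^ m.support.card * (g.coeff m ^ 2 * (n.choose k : ℝ)) := by gcongr
      _ = _ := by ring
  · rw [mul_zero, mul_zero]
    positivity

theorem abs_coeff_prod_le {ι : Type*} (s : Finset ι) (w σ : ι → ℝ) {K : ℝ}
    (hK : ∀ j ∈ s, |w j| * (1 + |σ j|) ≤ K) (e : ℕ) :
    |(∏ j ∈ s, (Polynomial.C (w j) * (Polynomial.X - Polynomial.C (σ j)))).coeff e| ≤
      K ^ s.card := by
  classical
  induction s using Finset.induction_on generalizing e with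
  | empty =>
    simp only [Finset.prod_empty, Polynomial.coeff_one, Finset.card_empty, pow_zero]
    split_ifs <;> simp
  | insert a s ha ih =>
    have ih := ih fun j hj => hK j (Finset.mem_insert_of_mem hj)
    have hKa := hK a (Finset.mem_insert_self a s)
    rw [Finset.prod_insert ha, Finset.card_insert_of_notMem ha]
    set P := ∏ j ∈ s, (Polynomial.C (w j) * (Polynomial.X - Polynomial.C (σ j))) with hP
    have hb : 0 ≤ K ^ s.card := (abs_nonneg _).trans (ih 0)
    have h1 : |(Polynomial.X * P).coeff e| ≤ K ^ s.card := by
      cases e with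
      | zero => simpa using hb
      | succ e => rw [Polynomial.coeff_X_mul]; exact ih e
    rw [mul_assoc, Polynomial.coeff_C_mul, sub_mul, Polynomial.coeff_sub, Polynomial.coeff_C_mul,
      abs_mul]
    calc |w a| * |(Polynomial.X * P).coeff e - σ a * P.coeff e|
        ≤ |w a| * (|(Polynomial.X * P).coeff e| + |σ a * P.coeff e|) := by
          gcongr; exact abs_sub _ _
      _ ≤ |w a| * (K ^ s.card + |σ a| * K ^ s.card) := by
          rw [abs_mul]; gcongr; exact ih e
      _ = |w a| * (1 + |σ a|) * K ^ s.card := by ring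
      _ ≤ K * K ^ s.card := by gcongr
      _ = K ^ (s.card + 1) := by ring

theorem coeff_eq_sum_lagrange {d : ℕ} {σ : Fin (d + 1) → ℝ} (hσ : Function.Injective σ)
    (a : Fin (d + 1) → ℝ) (e : Fin (d + 1)) :
    a e = ∑ i, (∑ l, a l * σ i ^ (l : ℕ)) * (Lagrange.basis Finset.univ σ i).coeff e := by
  set P : Polynomial ℝ := ∑ l : Fin (d + 1), Polynomial.C (a l) * Polynomial.X ^ (l : ℕ) with hP
  have hdeg : P.degree < (Finset.univ : Finset (Fin (d + 1))).card := by
    rw [Finset.card_univ, Fintype.card_fin, ← Polynomial.mem_degreeLT]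
    refine Submodule.sum_mem _ fun l _ => ?_
    rw [Polynomial.mem_degreeLT]
    exact (Polynomial.degree_C_mul_X_pow_le _ _).trans_lt (by exact_mod_cast l.2)
  have h := Lagrange.eq_interpolate (s := Finset.univ) (v := σ) hσ.injOn hdeg
  have hc := congrArg (fun Q => Polynomial.coeff Q (e : ℕ)) h
  simp only [Lagrange.interpolate_apply, Polynomial.finsetSum_coeff, Polynomial.coeff_C_mul] at hc
  have hl : P.coeff e = a e := by
    rw [hP]
    simp only [Polynomial.finsetSum_coeff, Polynomial.coeff_C_mul_X_pow]
    rw [Finset.sum_eq_single e]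
    · simp
    · intro b _ hb
      rw [if_neg]
      exact fun hh => hb (Fin.ext hh).symm
    · simp
  rw [← hl, hc]
  refine Finset.sum_congr rfl fun i _ => ?_
  congr 1
  simp [hP, Polynomial.eval_finsetSum]

theorem sq_coeff_le_sum_sq {d : ℕ} {σ : Fin (d + 1) → ℝ} {η M : ℝ} (hη : 0 < η) (hM : 1 ≤ M)
    (hsep : ∀ i j, i ≠ j → η ≤ |σ i - σ j|) (hbd : ∀ i, |σ i| ≤ M)
    (a : Fin (d + 1) → ℝ) (e : Fin (d + 1)) :
    a e ^ 2 ≤ (d + 1) * (2 * M / η) ^ (2 * d) * ∑ i, (∑ l, a l * σ i ^ (l : ℕ)) ^ 2 := by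
  have hinj : Function.Injective σ := by
    intro i j hij
    by_contra hne
    have := hsep i j hne
    rw [hij, sub_self, abs_zero] at this
    linarith
  have hcoeff : ∀ i, |(Lagrange.basis Finset.univ σ i).coeff e| ≤ (2 * M / η) ^ d := by
    intro i
    have h := abs_coeff_prod_le (Finset.univ.erase i) (fun j => (σ i - σ j)⁻¹) σ
      (K := 2 * M / η) (fun j hj => by
        have h1 := hsep i j (Finset.ne_of_mem_erase hj).symm
        rw [abs_inv, inv_mul_eq_div]
        have := hbd j
        gcongr
        linarith) e
    rw [Finset.card_erase_of_mem (Finset.mem_univ i), Finset.card_univ, Fintype.card_fin,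
      Nat.add_sub_cancel] at h
    exact h
  rw [coeff_eq_sum_lagrange hinj a e]
  refine (sq_sum_le_card_mul_sum_sq (s := Finset.univ)).trans ?_
  rw [Finset.card_univ, Fintype.card_fin, mul_assoc,
    Finset.mul_sum (a := (2 * M / η) ^ (2 * d))]
  push_cast
  gcongr with i
  rw [mul_pow, mul_comm, mul_comm 2 d, pow_mul]
  refine mul_le_mul_of_nonneg_right ?_ (sq_nonneg _)
  rw [← sq_abs]
  gcongr
  exact hcoeff i

/-- The multilinear polynomials of degree at most `j`. -/
noncomputable def multilinearSub (n j : ℕ) : Submodule ℝ (MvPolynomial (Fin n) ℝ) :=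
  restrictDegree (Fin n) ℝ 1 ⊓ restrictTotalDegree (Fin n) ℝ j

/-- The sum of all the partial derivatives. -/
noncomputable def sumPderiv (n : ℕ) : MvPolynomial (Fin n) ℝ →ₗ[ℝ] MvPolynomial (Fin n) ℝ :=
  ∑ i, (pderiv i).toLinearMap

/-- The harmonic multilinear polynomials of degree at most `j`. -/
noncomputable def harmonicSub (n j : ℕ) : Submodule ℝ (MvPolynomial (Fin n) ℝ) :=
  multilinearSub n j ⊓ LinearMap.ker (sumPderiv n)

theorem mem_multilinearSub {j : ℕ} {f : MvPolynomial (Fin n) ℝ} :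
    f ∈ multilinearSub n j ↔ IsMultilinear f ∧ f.totalDegree ≤ j := by
  rw [multilinearSub, Submodule.mem_inf, mem_restrictDegree, mem_restrictTotalDegree]
  rfl

theorem mem_harmonicSub {j : ℕ} {f : MvPolynomial (Fin n) ℝ} :
    f ∈ harmonicSub n j ↔ IsMultilinear f ∧ IsHarmonic f ∧ f.totalDegree ≤ j := by
  rw [harmonicSub, Submodule.mem_inf, mem_multilinearSub, LinearMap.mem_ker, sumPderiv,
    LinearMap.sum_apply, IsHarmonic]
  simp only [Derivation.coeFn_coe]
  tauto

theorem harmonicSub_mono {i j : ℕ} (h : i ≤ j) : harmonicSub n i ≤ harmonicSub n j := by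
  intro f hf
  rw [mem_harmonicSub] at hf ⊢
  exact ⟨hf.1, hf.2.1, hf.2.2.trans h⟩

theorem nat_succ_sq_le_four_pow (d : ℕ) : ((d : ℝ) + 1) ^ 2 ≤ 4 ^ d := by
  have h : d + 1 ≤ 2 ^ d := Nat.lt_two_pow_self
  have h' : (d : ℝ) + 1 ≤ 2 ^ d := by exact_mod_cast h
  calc ((d : ℝ) + 1) ^ 2 ≤ (2 ^ d) ^ 2 := by gcongr
    _ = 4 ^ d := by rw [← pow_mul, mul_comm, pow_mul]; norm_num

theorem cubeMass_nonneg {p : ℝ} (hp : 0 < p) (hp1 : p < 1) (x : Fin n → Bool) :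
    0 ≤ cubeMass p x :=
  Finset.prod_nonneg fun i _ => by split_ifs <;> linarith

theorem eq_zero_of_cubeSq_eq_zero {p : ℝ} (hp : 0 < p) (hp1 : p < 1)
    {g : MvPolynomial (Fin n) ℝ} (hg : IsMultilinear g) (hh : IsHarmonic g)
    (h : cubeSq p g = 0) : g = 0 := by
  have hq : 0 < p * (1 - p) := mul_pos hp (by linarith)
  rw [cubeSq_eq_sum_coeff hg hh] at h
  have h1 := (Finset.sum_eq_zero_iff_of_nonneg fun m _ =>
    mul_nonneg (sq_nonneg _) (pow_nonneg hq.le _)).1 h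
  rw [← support_eq_empty, Finset.eq_empty_iff_forall_notMem]
  intro m hm
  have := h1 m hm
  simp [(pow_pos hq _).ne'] at this
  exact mem_support_iff.1 hm this

theorem cubeSq_le_of_isSystem {d : ℕ} {p η M : ℝ} (hp : 0 < p) (hp1 : p < 1)
    (hd : (d : ℝ) ≤ Real.sqrt (n * p * (1 - p))) {k : Fin (d + 1) → ℕ}
    (hk : IsSystem n p η M k) (hM : M ≤ Real.sqrt (n * p * (1 - p)) / 2)
    {F : Fin (d + 1) → MvPolynomial (Fin n) ℝ} (hF : ∀ e, F e ∈ harmonicSub n d) {A : ℝ}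
    (hA : ∀ i, ∑ x ∈ slice n (k i),
      (∑ e, eval (point x) (F e) * standardize n p (∑ i, point x i) ^ (e : ℕ)) ^ 2 ≤
        A * n.choose (k i))
    (e : Fin (d + 1)) : cubeSq p (F e) ≤ (16 * (M / η)) ^ (2 * d) * A := by
  have hη := hk.eta_pos
  have hM1 := hk.one_le_M
  have hn : 0 < n := by
    rcases Nat.eq_zero_or_pos n with rfl | h
    · simp at hM; linarith
    · exact h
  set σ : Fin (d + 1) → ℝ := fun i => standardize n p (k i) with hσ
  set H : Fin (d + 1) → MvPolynomial (Fin n) ℝ := fun i =>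
    ∑ l : Fin (d + 1), (σ i ^ (l : ℕ)) • F l with hH
  have hHmem : ∀ i, H i ∈ harmonicSub n d := fun i =>
    Submodule.sum_mem _ fun l _ => Submodule.smul_mem _ _ (hF l)
  have hHeval : ∀ i (x : Fin n → Bool),
      eval (point x) (H i) = ∑ l, eval (point x) (F l) * σ i ^ (l : ℕ) := by
    intro i x
    simp only [hH, map_sum, smul_eval]
    exact Finset.sum_congr rfl fun l _ => mul_comm _ _
  have hcen : ∀ i, IsCentral n d p (k i) := fun i =>
    IsCentral.of_standardize hp hp1 hd (by linarith) (hk.le_n i) ((hk.bounded i).trans hM)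
  have hHbd : ∀ i, cubeSq p (H i) ≤ 16 ^ d * A := by
    intro i
    obtain ⟨h1, h2, h3⟩ := mem_harmonicSub.1 (hHmem i)
    refine (cubeSq_le_of_isCentral h1 h2 h3 hp hp1 hn (hcen i)).trans ?_
    have hc : (0 : ℝ) < n.choose (k i) := by exact_mod_cast Nat.choose_pos (hk.le_n i)
    gcongr
    rw [div_le_iff₀ hc]
    refine le_of_eq_of_le ?_ (hA i)
    refine Finset.sum_congr rfl fun x hx => ?_
    rw [hHeval, sum_point_of_mem_slice hx]
  have hA0 : 0 ≤ A := by
    have h0 : 0 ≤ cubeSq p (H 0) := Finset.sum_nonneg fun x _ =>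
      mul_nonneg (cubeMass_nonneg hp hp1 x) (sq_nonneg _)
    exact nonneg_of_mul_nonneg_right (h0.trans (hHbd 0)) (by positivity)
  calc cubeSq p (F e)
      ≤ ∑ x : Fin n → Bool, cubeMass p x * ((d + 1) * (2 * M / η) ^ (2 * d) *
          ∑ i, (eval (point x) (H i)) ^ 2) := by
        refine Finset.sum_le_sum fun x _ => ?_
        refine mul_le_mul_of_nonneg_left ?_ (cubeMass_nonneg hp hp1 x)
        have := sq_coeff_le_sum_sq hη hM1 hk.separated hk.bounded
          (fun l => eval (point x) (F l)) e
        simpa only [hHeval] using this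
    _ = (d + 1) * (2 * M / η) ^ (2 * d) * ∑ i, cubeSq p (H i) := by
        simp only [cubeSq]
        rw [Finset.sum_comm, Finset.mul_sum]
        refine Finset.sum_congr rfl fun x _ => ?_
        rw [← Finset.mul_sum]
        ring
    _ ≤ (d + 1) * (2 * M / η) ^ (2 * d) * ∑ _i : Fin (d + 1), 16 ^ d * A := by
        gcongr with i
        exact hHbd i
    _ = ((d : ℝ) + 1) ^ 2 * ((2 * M / η) ^ (2 * d) * (16 ^ d * A)) := by
        rw [Finset.sum_const, Finset.card_univ, Fintype.card_fin, nsmul_eq_mul]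
        push_cast
        ring
    _ ≤ 4 ^ d * ((2 * M / η) ^ (2 * d) * (16 ^ d * A)) := by
        gcongr
        exact nat_succ_sq_le_four_pow d
    _ = (16 * (M / η)) ^ (2 * d) * A := by
        rw [pow_mul, pow_mul, ← mul_assoc, ← mul_assoc, ← mul_pow, ← mul_pow]
        congr 2
        ring

instance (n j : ℕ) : Module.Finite ℝ (multilinearSub n j) :=
  Submodule.finiteDimensional_inf_left _ _

instance (n j : ℕ) : Module.Finite ℝ (harmonicSub n j) :=
  Submodule.finiteDimensional_inf_left _ _

theorem sumPderiv_mem {j : ℕ} {f : MvPolynomial (Fin n) ℝ} (hf : f ∈ multilinearSub n (j + 1)) :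
    sumPderiv n f ∈ multilinearSub n j := by
  rw [mem_multilinearSub] at hf
  rw [sumPderiv, LinearMap.sum_apply]
  refine Submodule.sum_mem _ fun i _ => ?_
  rw [mem_multilinearSub]
  have key : ∀ m ∈ (pderiv i f).support, m + Finsupp.single i 1 ∈ f.support := by
    intro m hm
    rw [mem_support_iff, coeff_pderiv] at hm
    exact mem_support_iff.2 (left_ne_zero_of_mul hm)
  refine ⟨fun m hm l => ?_, ?_⟩
  · have := hf.1 _ (key m hm) l
    rw [Finsupp.add_apply] at this
    omega
  · refine Finset.sup_le fun m hm => ?_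
    have h1 := (le_totalDegree (key m hm)).trans hf.2
    have h2 : (m + Finsupp.single i 1).sum (fun _ e => e) = m.sum (fun _ e => e) + 1 := by
      rw [Finsupp.sum_add_index' (fun _ => rfl) (fun _ _ _ => rfl), Finsupp.sum_single_index rfl]
    omega

theorem harmonicSub_zero : harmonicSub n 0 = multilinearSub n 0 := by
  refine le_antisymm inf_le_left fun f hf => ?_
  refine ⟨hf, ?_⟩
  have h := (mem_multilinearSub.1 hf).2
  rw [totalDegree_eq_zero_iff_eq_C.1 (Nat.le_zero.1 h)]
  simp [sumPderiv]

theorem finrank_multilinearSub_succ_le (n j : ℕ) :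
    Module.finrank ℝ (multilinearSub n (j + 1)) ≤
      Module.finrank ℝ (harmonicSub n (j + 1)) + Module.finrank ℝ (multilinearSub n j) := by
  let L : multilinearSub n (j + 1) →ₗ[ℝ] multilinearSub n j :=
    (sumPderiv n).restrict fun f hf => sumPderiv_mem hf
  have h1 := L.finrank_range_add_finrank_ker
  have h2 : Module.finrank ℝ (LinearMap.range L) ≤ Module.finrank ℝ (multilinearSub n j) :=
    Submodule.finrank_le _
  have h3 : Module.finrank ℝ (LinearMap.ker L) ≤ Module.finrank ℝ (harmonicSub n (j + 1)) := by
    rw [← Submodule.finrank_map_subtype_eq]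
    refine Submodule.finrank_mono ?_
    rintro _ ⟨f, hf, rfl⟩
    refine ⟨f.2, ?_⟩
    have : L f = 0 := hf
    exact congrArg Subtype.val this
  omega

theorem finrank_multilinearSub_le_sum (n d : ℕ) :
    Module.finrank ℝ (multilinearSub n d) ≤
      ∑ e : Fin (d + 1), Module.finrank ℝ (harmonicSub n (d - e)) := by
  induction d with
  | zero =>
    rw [Fin.sum_univ_one, Fin.val_zero, Nat.sub_zero, harmonicSub_zero]
  | succ d ih =>
    rw [Fin.sum_univ_succ]
    have h := finrank_multilinearSub_succ_le n d
    have hs : ∀ e : Fin (d + 1), Module.finrank ℝ (harmonicSub n (d + 1 - e.succ)) =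
        Module.finrank ℝ (harmonicSub n (d - e)) := fun e => by
      rw [Fin.val_succ, Nat.add_sub_add_right]
    rw [Finset.sum_congr rfl fun e _ => hs e, Fin.val_zero, Nat.sub_zero]
    omega

theorem exists_multilinear_eval_eq {j : ℕ} {f : MvPolynomial (Fin n) ℝ} (hf : f.totalDegree ≤ j) :
    ∃ g ∈ multilinearSub n j, ∀ x : Fin n → Bool, eval (point x) g = eval (point x) f := by
  let r : (Fin n →₀ ℕ) → (Fin n →₀ ℕ) := fun m => m.mapRange (fun e => min e 1) rfl
  refine ⟨∑ m ∈ f.support, monomial (r m) (f.coeff m), Submodule.sum_mem _ fun m hm => ?_,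
    fun x => ?_⟩
  · rw [mem_multilinearSub]
    refine ⟨fun m' hm' i => ?_, ?_⟩
    · have : m' = r m := by simpa using support_monomial_subset hm'
      simp [this, r]
    · refine (totalDegree_monomial_le _ _).trans (le_trans ?_ ((le_totalDegree hm).trans hf))
      rw [Finsupp.sum_fintype _ _ fun _ => rfl, Finsupp.sum_fintype _ _ fun _ => rfl]
      exact Finset.sum_le_sum fun i _ => by simp [r]
  · rw [map_sum, MvPolynomial.eval_eq]
    refine Finset.sum_congr rfl fun m _ => ?_
    rw [eval_monomial, Finsupp.prod_fintype _ _ fun _ => pow_zero _]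
    congr 1
    rw [Finset.prod_subset (Finset.subset_univ m.support)
      (fun i _ hi => by rw [Finsupp.notMem_support_iff.1 hi, pow_zero])]
    refine Finset.prod_congr rfl fun i _ => ?_
    simp only [r, Finsupp.mapRange_apply, point]
    split_ifs
    · simp
    · rcases Nat.eq_zero_or_pos (m i) with h | h
      · simp [h]
      · rw [min_eq_right h, zero_pow one_ne_zero, zero_pow h.ne']

/-- The standardization of `x₁ + ⋯ + xₙ` as a polynomial. -/
noncomputable def standardPoly (n : ℕ) (p : ℝ) : MvPolynomial (Fin n) ℝ :=
  C (Real.sqrt (n * p * (1 - p)))⁻¹ * (∑ i, X i - C (n * p))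

theorem eval_standardPoly (p : ℝ) (y : Fin n → ℝ) :
    eval y (standardPoly n p) = standardize n p (∑ i, y i) := by
  simp [standardPoly, standardize, div_eq_inv_mul]

theorem totalDegree_standardPoly_le (n : ℕ) (p : ℝ) : (standardPoly n p).totalDegree ≤ 1 := by
  refine (totalDegree_mul _ _).trans ?_
  rw [totalDegree_C, zero_add]
  refine (totalDegree_sub _ _).trans (max_le ?_ ((totalDegree_C _).trans_le zero_le_one))
  exact totalDegree_finsetSum_le fun i _ => (totalDegree_X i).le

/-- The function on the cube with given coefficients in the powers of the standardized sum. -/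
noncomputable def expansionMap (n d : ℕ) (p : ℝ) :
    (∀ e : Fin (d + 1), harmonicSub n (d - e)) →ₗ[ℝ] ((Fin n → Bool) → ℝ) where
  toFun F x := ∑ e, eval (point x) (F e : MvPolynomial (Fin n) ℝ) *
    standardize n p (∑ i, point x i) ^ (e : ℕ)
  map_add' F G := by
    ext x
    simp [add_mul, Finset.sum_add_distrib]
  map_smul' c F := by
    ext x
    simp [Finset.mul_sum, mul_assoc]

/-- Restriction of a polynomial to the cube. -/
noncomputable def evalCube (n : ℕ) : MvPolynomial (Fin n) ℝ →ₗ[ℝ] ((Fin n → Bool) → ℝ) :=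
  LinearMap.pi fun x => (aeval (point x)).toLinearMap

theorem evalCube_apply (f : MvPolynomial (Fin n) ℝ) (x : Fin n → Bool) :
    evalCube n f x = eval (point x) f := by
  simp [evalCube]

theorem range_expansionMap {d : ℕ} {p : ℝ} (h : Function.Injective (expansionMap n d p)) :
    LinearMap.range (expansionMap n d p) = (multilinearSub n d).map (evalCube n) := by
  refine Submodule.eq_of_le_of_finrank_le ?_ ?_
  · rintro _ ⟨F, rfl⟩
    have hdeg : (∑ e, (F e : MvPolynomial (Fin n) ℝ) * standardPoly n p ^ (e : ℕ)).totalDegree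
        ≤ d := by
      refine totalDegree_finsetSum_le fun e _ => (totalDegree_mul _ _).trans ?_
      have h1 := (mem_harmonicSub.1 (F e).2).2.2
      have h2 := (totalDegree_pow (standardPoly n p) e).trans
        (Nat.mul_le_mul_left _ (totalDegree_standardPoly_le n p))
      have := e.2
      omega
    obtain ⟨g, hg, hgf⟩ := exists_multilinear_eval_eq hdeg
    refine ⟨g, hg, ?_⟩
    ext x
    rw [evalCube_apply, hgf, map_sum]
    simp [expansionMap, eval_standardPoly]
  · rw [LinearMap.finrank_range_of_inj h, Module.finrank_pi_fintype]
    exact (Submodule.finrank_map_le _ _).trans (finrank_multilinearSub_le_sum n d)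

theorem isBlekhermanExpansion_iff {d : ℕ} {p : ℝ} {f : MvPolynomial (Fin n) ℝ}
    {F : Fin (d + 1) → MvPolynomial (Fin n) ℝ} :
    IsBlekhermanExpansion p d f F ↔ (∀ e : Fin (d + 1), F e ∈ harmonicSub n (d - e)) ∧
      ∀ x : Fin n → Bool, eval (point x) f =
        ∑ e, eval (point x) (F e) * standardize n p (∑ i, point x i) ^ (e : ℕ) := by
  simp only [mem_harmonicSub]
  exact ⟨fun h => ⟨fun e => ⟨h.multilinear e, h.harmonic e, h.degree_le e⟩, h.expansion⟩,
    fun h => ⟨fun e => (h.1 e).1, fun e => (h.1 e).2.1, fun e => (h.1 e).2.2, h.2⟩⟩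

theorem existsUnique_isBlekhermanExpansion {d : ℕ} {p : ℝ}
    (h : Function.Injective (expansionMap n d p)) {f : MvPolynomial (Fin n) ℝ}
    (hf : IsMultilinear f) (hd : f.totalDegree ≤ d) :
    ∃! F : Fin (d + 1) → MvPolynomial (Fin n) ℝ, IsBlekhermanExpansion p d f F := by
  have hmem : evalCube n f ∈ LinearMap.range (expansionMap n d p) := by
    rw [range_expansionMap h]
    exact ⟨f, mem_multilinearSub.2 ⟨hf, hd⟩, rfl⟩
  obtain ⟨F, hF⟩ := hmem
  refine ⟨fun e : Fin (d + 1) => F e, isBlekhermanExpansion_iff.2 ⟨fun e => (F e).2, fun x => ?_⟩, ?_⟩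
  · rw [← evalCube_apply, ← hF]
    rfl
  · intro G hG
    obtain ⟨hG1, hG2⟩ := isBlekhermanExpansion_iff.1 hG
    have : (fun e => ⟨G e, hG1 e⟩ : ∀ e : Fin (d + 1), harmonicSub n (d - e)) = F := by
      refine h ?_
      rw [hF]
      ext x
      rw [evalCube_apply, hG2]
      rfl
    rw [← this]

theorem injective_expansionMap {d : ℕ} {p η M : ℝ} (hp : 0 < p) (hp1 : p < 1)
    (hd : (d : ℝ) ≤ Real.sqrt (n * p * (1 - p))) {k : Fin (d + 1) → ℕ}
    (hk : IsSystem n p η M k) (hM : M ≤ Real.sqrt (n * p * (1 - p)) / 2) :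
    Function.Injective (expansionMap n d p) := by
  rw [← LinearMap.ker_eq_bot, LinearMap.ker_eq_bot']
  intro F hF
  have hF' : ∀ e, (F e : MvPolynomial (Fin n) ℝ) ∈ harmonicSub n d := fun e =>
    harmonicSub_mono (Nat.sub_le _ _) (F e).2
  ext1 e
  have h := cubeSq_le_of_isSystem hp hp1 hd hk hM hF' (A := 0) (fun i => by
    refine le_of_eq ?_
    rw [zero_mul]
    refine Finset.sum_eq_zero fun x _ => ?_
    have := congrFun hF x
    rw [sq_eq_zero_iff]
    exact this) e
  rw [mul_zero] at h
  obtain ⟨h1, h2, -⟩ := mem_harmonicSub.1 (F e).2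
  have h0 : 0 ≤ cubeSq p (F e : MvPolynomial (Fin n) ℝ) := Finset.sum_nonneg fun x _ =>
    mul_nonneg (cubeMass_nonneg hp hp1 x) (sq_nonneg _)
  exact Subtype.ext (eq_zero_of_cubeSq_eq_zero hp hp1 h1 h2 (le_antisymm h h0))

theorem sum_cubeMass_mul_exp (p t : ℝ) :
    ∑ x : Fin n → Bool, cubeMass p x * Real.exp (t * (∑ i, point x i - n * p)) =
      (p * Real.exp (t * (1 - p)) + (1 - p) * Real.exp (-(t * p))) ^ n := by
  have h := Fintype.prod_sum (ι := Fin n) (κ := fun _ => Bool) (fun (_ : Fin n) (b : Bool) =>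
    (if b then p else 1 - p) * Real.exp (t * ((if b then 1 else 0) - p)))
  simp only [Fintype.sum_bool, Finset.prod_const, Finset.card_univ, Fintype.card_fin] at h
  simp only [if_true, Bool.false_eq_true, if_false, zero_sub, mul_neg] at h
  rw [h]
  refine Finset.sum_congr rfl fun x _ => ?_
  rw [Finset.prod_mul_distrib, ← Real.exp_sum, ← Finset.mul_sum, Finset.sum_sub_distrib]
  simp [cubeMass, point]

theorem sum_cubeMass_mul_exp_le {p t : ℝ} (hp : 0 < p) (hp1 : p < 1) (ht : |t| ≤ 1) :
    ∑ x : Fin n → Bool, cubeMass p x * Real.exp (t * (∑ i, point x i - n * p)) ≤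
      Real.exp (n * t ^ 2) := by
  have hexp : ∀ u : ℝ, |u| ≤ 1 → Real.exp u ≤ 1 + u + u ^ 2 := fun u hu => by
    have := (abs_le.1 (Real.abs_exp_sub_one_sub_id_le hu)).2
    linarith
  have hq : 0 < 1 - p := by linarith
  rw [sum_cubeMass_mul_exp, Real.exp_nat_mul]
  gcongr
  have h1 : |t * (1 - p)| ≤ 1 := by
    rw [abs_mul, abs_of_pos hq]; exact mul_le_one₀ ht hq.le (by linarith)
  have h2 : |-(t * p)| ≤ 1 := by
    rw [abs_neg, abs_mul, abs_of_pos hp]; exact mul_le_one₀ ht hp.le hp1.le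
  calc p * Real.exp (t * (1 - p)) + (1 - p) * Real.exp (-(t * p))
      ≤ p * (1 + t * (1 - p) + (t * (1 - p)) ^ 2) +
        (1 - p) * (1 + -(t * p) + (-(t * p)) ^ 2) := by
        gcongr
        · exact hexp _ h1
        · exact hexp _ h2
    _ = p * (1 - p) * t ^ 2 + 1 := by ring
    _ ≤ 1 * t ^ 2 + 1 := by gcongr; nlinarith
    _ ≤ Real.exp (t ^ 2) := by rw [one_mul]; exact Real.add_one_le_exp _

theorem sum_cubeMass_mul_standardize_le {p : ℝ} (hp : 0 < p) (hp1 : p < 1) (hn : 0 < n) (e : ℕ) :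
    (p * (1 - p)) ^ e * ∑ x : Fin n → Bool,
      cubeMass p x * standardize n p (∑ i, point x i) ^ (2 * e) ≤ 6 * (2 * e).factorial := by
  have hq : 0 < 1 - p := by linarith
  have hmass : ∀ x : Fin n → Bool, 0 ≤ cubeMass p x := fun x =>
    Finset.prod_nonneg fun i _ => by split_ifs <;> linarith
  have hnr : (1 : ℝ) ≤ n := by exact_mod_cast hn
  set t : ℝ := (Real.sqrt n)⁻¹ with ht
  have ht1 : |t| ≤ 1 := by
    rw [ht, abs_inv, abs_of_nonneg (Real.sqrt_nonneg _)]
    exact inv_le_one_of_one_le₀ (Real.one_le_sqrt.2 hnr)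
  have ht2 : n * t ^ 2 = 1 := by
    rw [ht, inv_pow, Real.sq_sqrt (by positivity)]
    field_simp
  have hb1 := sum_cubeMass_mul_exp_le (n := n) hp hp1 ht1
  have hb2 := sum_cubeMass_mul_exp_le (n := n) hp hp1 (t := -t) (by rwa [abs_neg])
  rw [neg_sq, ht2] at hb2
  rw [ht2] at hb1
  have hpt : ∀ x : Fin n → Bool,
      (p * (1 - p)) ^ e * standardize n p (∑ i, point x i) ^ (2 * e) ≤
        (2 * e).factorial * (Real.exp (t * (∑ i, point x i - n * p)) +
          Real.exp (-t * (∑ i, point x i - n * p))) := by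
    intro x
    set y : ℝ := t * (∑ i, point x i - n * p) with hy
    have h1 : (p * (1 - p)) ^ e * standardize n p (∑ i, point x i) ^ (2 * e) = |y| ^ (2 * e) := by
      rw [pow_mul, pow_mul, ← mul_pow (p * (1 - p)), sq_abs, standardize, div_pow,
        Real.sq_sqrt (by positivity), hy, mul_pow t]
      congr 1
      have : t ^ 2 = 1 / n := by field_simp; linarith
      rw [this]
      field_simp
    have h2 := Real.pow_div_factorial_le_exp |y| (abs_nonneg y) (2 * e)
    have h3 : Real.exp |y| ≤ Real.exp y + Real.exp (-y) := Real.exp_abs_le y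
    rw [div_le_iff₀ (by positivity)] at h2
    rw [h1, neg_mul]
    calc |y| ^ (2 * e) ≤ Real.exp |y| * (2 * e).factorial := h2
      _ ≤ (Real.exp y + Real.exp (-y)) * (2 * e).factorial := by gcongr
      _ = _ := mul_comm _ _
  rw [Finset.mul_sum]
  calc ∑ x : Fin n → Bool, (p * (1 - p)) ^ e *
        (cubeMass p x * standardize n p (∑ i, point x i) ^ (2 * e))
      ≤ ∑ x : Fin n → Bool, cubeMass p x * ((2 * e).factorial *
        (Real.exp (t * (∑ i, point x i - n * p)) + Real.exp (-t * (∑ i, point x i - n * p)))) := by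
        refine Finset.sum_le_sum fun x _ => ?_
        rw [mul_left_comm]
        exact mul_le_mul_of_nonneg_left (hpt x) (hmass x)
    _ = (2 * e).factorial * (
        ∑ x : Fin n → Bool, cubeMass p x * Real.exp (t * (∑ i, point x i - n * p)) +
        ∑ x : Fin n → Bool, cubeMass p x * Real.exp (-t * (∑ i, point x i - n * p))) := by
        rw [← Finset.sum_add_distrib, Finset.mul_sum]
        exact Finset.sum_congr rfl fun x _ => by ring
    _ ≤ (2 * e).factorial * (3 + 3) := by
        have := Real.exp_one_lt_d9
        gcongr <;> linarith
    _ = _ := by ring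

theorem cubeSq_nonneg {p : ℝ} (hp : 0 < p) (hp1 : p < 1) (f : MvPolynomial (Fin n) ℝ) :
    0 ≤ cubeSq p f :=
  Finset.sum_nonneg fun x _ => mul_nonneg (cubeMass_nonneg hp hp1 x) (sq_nonneg _)

theorem cubeNorm_le_of_cubeSq_le {p b : ℝ} {f : MvPolynomial (Fin n) ℝ} {d : ℕ} (hb : 0 ≤ b)
    (h : cubeSq p f ≤ b ^ (2 * d)) : cubeNorm p f ≤ b ^ d := by
  refine Real.sqrt_le_iff.2 ⟨by positivity, ?_⟩
  rwa [← pow_mul, mul_comm d 2]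

theorem sum_slice_le_of_sliceNorm_le_one {k : ℕ} (hk : k ≤ n) {f : MvPolynomial (Fin n) ℝ}
    (h : sliceNorm k f ≤ 1) : sliceSum k f ≤ n.choose k := by
  have hc : (0 : ℝ) < n.choose k := by exact_mod_cast Nat.choose_pos hk
  rw [sliceNorm, Real.sqrt_le_iff, card_slice, one_pow, div_le_one hc] at h
  exact h.2

theorem cubeSq_mul_standardize_le {g : MvPolynomial (Fin n) ℝ} {d e : ℕ}
    (hg : g ∈ harmonicSub n d) (hn : 2 * d ≤ n) (hn0 : 0 < n) (he : e ≤ d)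
    {p : ℝ} (hp : 0 < p) (hp1 : p < 1) :
    (p * (1 - p)) ^ (2 * d) * ∑ x : Fin n → Bool, cubeMass p x *
      (eval (point x) g * standardize n p (∑ i, point x i) ^ e) ^ 2 ≤
      6 * (2 * d).factorial * cubeSq p g := by
  have hq : 0 < 1 - p := by linarith
  have hpq : p * (1 - p) ≤ 1 := by nlinarith
  obtain ⟨h1, h2, h3⟩ := mem_harmonicSub.1 hg
  have hmom := sum_cubeMass_mul_standardize_le hp hp1 hn0 e
  set v : ℝ := ∑ x : Fin n → Bool,
    cubeMass p x * standardize n p (∑ i, point x i) ^ (2 * e) with hv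
  have hv0 : 0 ≤ v := Finset.sum_nonneg fun x _ =>
    mul_nonneg (cubeMass_nonneg hp hp1 x) (by rw [pow_mul]; positivity)
  have hkey : (p * (1 - p)) ^ d * ∑ x : Fin n → Bool, cubeMass p x *
      (eval (point x) g * standardize n p (∑ i, point x i) ^ e) ^ 2 ≤ v * cubeSq p g := by
    rw [hv, sum_cubeMass_mul, sum_cubeMass_mul, Finset.mul_sum, Finset.sum_mul]
    refine Finset.sum_le_sum fun k hk => ?_
    have hk : k ≤ n := by simpa [Nat.lt_succ_iff] using hk
    have e1 : ∑ x ∈ slice n k, (eval (point x) g * standardize n p (∑ i, point x i) ^ e) ^ 2 =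
        standardize n p k ^ (2 * e) * sliceSum k g := by
      rw [sliceSum, Finset.mul_sum]
      refine Finset.sum_congr rfl fun x hx => ?_
      rw [sum_point_of_mem_slice hx]
      ring
    have e2 : ∑ x ∈ slice n k, standardize n p (∑ i, point x i) ^ (2 * e) =
        standardize n p k ^ (2 * e) * n.choose k := by
      rw [← card_slice, mul_comm (_ ^ _), ← nsmul_eq_mul, ← Finset.sum_const]
      exact Finset.sum_congr rfl fun x hx => by rw [sum_point_of_mem_slice hx]
    rw [e1, e2]
    have h4 := sliceSum_le_cubeSq h1 h2 h3 hn hp hp1 hk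
    have h5 : 0 ≤ standardize n p k ^ (2 * e) := by rw [pow_mul]; positivity
    calc (p * (1 - p)) ^ d * (p ^ k * (1 - p) ^ (n - k) *
          (standardize n p k ^ (2 * e) * sliceSum k g))
        = p ^ k * (1 - p) ^ (n - k) * standardize n p k ^ (2 * e) *
          ((p * (1 - p)) ^ d * sliceSum k g) := by ring
      _ ≤ p ^ k * (1 - p) ^ (n - k) * standardize n p k ^ (2 * e) *
          (n.choose k * cubeSq p g) := by gcongr
      _ = _ := by ring
  have h0 := cubeSq_nonneg hp hp1 g
  calc _ = (p * (1 - p)) ^ d * ((p * (1 - p)) ^ d * ∑ x : Fin n → Bool, cubeMass p x *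
      (eval (point x) g * standardize n p (∑ i, point x i) ^ e) ^ 2) := by ring
    _ ≤ (p * (1 - p)) ^ d * (v * cubeSq p g) := by gcongr
    _ ≤ (p * (1 - p)) ^ e * (v * cubeSq p g) := by
        refine mul_le_mul_of_nonneg_right ?_ (by positivity)
        exact pow_le_pow_of_le_one (by positivity) hpq he
    _ = (p * (1 - p)) ^ e * v * cubeSq p g := by ring
    _ ≤ 6 * (2 * e).factorial * cubeSq p g := by gcongr
    _ ≤ 6 * (2 * d).factorial * cubeSq p g := by gcongr

theorem cubeSq_le_of_expansion {f : MvPolynomial (Fin n) ℝ} {d : ℕ} (hn : 2 * d ≤ n)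
    (hn0 : 0 < n) {p : ℝ} (hp : 0 < p) (hp1 : p < 1)
    {F : Fin (d + 1) → MvPolynomial (Fin n) ℝ} (hF : IsBlekhermanExpansion p d f F) {A : ℝ}
    (hA : ∀ e, cubeSq p (F e) ≤ A) :
    (p * (1 - p)) ^ (2 * d) * cubeSq p f ≤ 4 ^ d * (6 * (2 * d).factorial * A) := by
  have hq : 0 < 1 - p := by linarith
  obtain ⟨hF1, hF2⟩ := isBlekhermanExpansion_iff.1 hF
  have hA0 : 0 ≤ A := (cubeSq_nonneg hp hp1 _).trans (hA 0)
  calc (p * (1 - p)) ^ (2 * d) * cubeSq p f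
      ≤ (p * (1 - p)) ^ (2 * d) * ∑ x : Fin n → Bool, cubeMass p x * ((d + 1) * ∑ e,
          (eval (point x) (F e) * standardize n p (∑ i, point x i) ^ (e : ℕ)) ^ 2) := by
        rw [cubeSq]
        gcongr with x
        · exact cubeMass_nonneg hp hp1 x
        · rw [hF2]
          refine (sq_sum_le_card_mul_sum_sq (s := Finset.univ)).trans_eq ?_
          rw [Finset.card_univ, Fintype.card_fin]
          push_cast
          rfl
    _ = (d + 1) * ∑ e, (p * (1 - p)) ^ (2 * d) * ∑ x : Fin n → Bool, cubeMass p x *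
          (eval (point x) (F e) * standardize n p (∑ i, point x i) ^ (e : ℕ)) ^ 2 := by
        rw [← Finset.mul_sum, Finset.sum_comm, Finset.mul_sum, Finset.mul_sum, Finset.mul_sum]
        refine Finset.sum_congr rfl fun x _ => ?_
        rw [← Finset.mul_sum]
        ring
    _ ≤ (d + 1) * ∑ _e : Fin (d + 1), 6 * (2 * d).factorial * A := by
        refine mul_le_mul_of_nonneg_left (Finset.sum_le_sum fun e _ => ?_) (by positivity)
        refine (cubeSq_mul_standardize_le (harmonicSub_mono (Nat.sub_le _ _) (hF1 e)) hn hn0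
          (Nat.lt_succ_iff.1 e.2) hp hp1).trans ?_
        have := hA e
        gcongr
    _ = ((d : ℝ) + 1) ^ 2 * (6 * (2 * d).factorial * A) := by
        rw [Finset.sum_const, Finset.card_univ, Fintype.card_fin, nsmul_eq_mul]
        push_cast
        ring
    _ ≤ 4 ^ d * (6 * (2 * d).factorial * A) := by
        gcongr
        exact nat_succ_sq_le_four_pow d

theorem cubeSq_le_pow {f : MvPolynomial (Fin n) ℝ} {d : ℕ} (hn : 2 * d ≤ n) (hn0 : 0 < n)
    {p R : ℝ} (hp : 0 < p) (hp1 : p < 1) (hR : 0 ≤ R)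
    {F : Fin (d + 1) → MvPolynomial (Fin n) ℝ} (hF : IsBlekhermanExpansion p d f F)
    (hA : ∀ e, cubeSq p (F e) ≤ (16 * R) ^ (2 * d)) :
    cubeSq p f ≤ (160 * (d / (p * (1 - p)) * R)) ^ (2 * d) := by
  have hpq : 0 < p * (1 - p) := mul_pos hp (by linarith)
  rcases Nat.eq_zero_or_pos d with rfl | hd
  · have h1 : cubeSq p f = cubeSq p (F 0) := by
      refine Finset.sum_congr rfl fun x _ => ?_
      rw [hF.expansion x]
      simp
    simpa [h1] using hA 0
  · have h := cubeSq_le_of_expansion hn hn0 hp hp1 hF hA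
    have hfac : ((2 * d).factorial : ℝ) ≤ (2 * d) ^ (2 * d) := by
      exact_mod_cast Nat.factorial_le_pow (2 * d)
    have h6 : (4 : ℝ) ^ d * 6 ≤ 5 ^ (2 * d) := by
      have : (6 : ℝ) ≤ 6 ^ d := le_self_pow₀ (by norm_num) hd.ne'
      calc (4 : ℝ) ^ d * 6 ≤ 4 ^ d * 6 ^ d := by gcongr
        _ = 24 ^ d := by rw [← mul_pow]; norm_num
        _ ≤ 25 ^ d := by gcongr; norm_num
        _ = 5 ^ (2 * d) := by rw [pow_mul]; norm_num
    refine le_of_mul_le_mul_left (h.trans ?_) (pow_pos hpq (2 * d))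
    calc (4 : ℝ) ^ d * (6 * (2 * d).factorial * (16 * R) ^ (2 * d))
        = 4 ^ d * 6 * ((2 * d).factorial * (16 * R) ^ (2 * d)) := by ring
      _ ≤ 5 ^ (2 * d) * ((2 * d) ^ (2 * d) * (16 * R) ^ (2 * d)) := by gcongr
      _ = _ := by
        rw [← mul_pow, ← mul_pow, ← mul_pow]
        congr 1
        have hv := hpq.ne'
        generalize p * (1 - p) = v at hv
        field_simp
        ring

end SliceCube

theorem mainTheorem5 :
    ∃ C : ℝ, 0 < C ∧ ∃ B : ℕ,
      ∀ (n d : ℕ) (p : ℝ), 0 < p → p < 1 → (d : ℝ) ≤ Real.sqrt (n * p * (1 - p)) →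
      ∀ (η M : ℝ) (k : Fin (d + 1) → ℕ), SliceCube.IsSystem n p η M k →
        M ≤ Real.sqrt (n * p * (1 - p)) / 2 →
      ∀ f : MvPolynomial (Fin n) ℝ, SliceCube.IsMultilinear f → f.totalDegree ≤ d →
        (∀ i, SliceCube.sliceNorm (k i) f ≤ 1) →
        SliceCube.cubeNorm p f ≤ (C * (d / (p * (1 - p)) * (M / η))) ^ (B * d) ∧
        (∃! F : Fin (d + 1) → MvPolynomial (Fin n) ℝ, SliceCube.IsBlekhermanExpansion p d f F) ∧
        ∀ F : Fin (d + 1) → MvPolynomial (Fin n) ℝ, SliceCube.IsBlekhermanExpansion p d f F →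
          ∀ e, SliceCube.cubeNorm p (F e) ≤ (C * (M / η)) ^ d := by
  open SliceCube in
  refine ⟨160, by norm_num, 1, fun n d p hp hp1 hd η M k hk hM f hf hfd hfk => ?_⟩
  have hη := hk.eta_pos
  have hM1 := hk.one_le_M
  have hR : 0 ≤ M / η := by positivity
  have hpq : 0 < p * (1 - p) := mul_pos hp (by linarith)
  have hn0 : 0 < n := by
    rcases Nat.eq_zero_or_pos n with rfl | h
    · simp at hM; linarith
    · exact h
  have hcen := IsCentral.of_standardize hp hp1 hd (by linarith) (hk.le_n 0)
    ((hk.bounded 0).trans hM)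
  have hn : 2 * d ≤ n := by
    have h1 := hcen.le_k hp hn0
    have h2 := hcen.add_le hp1 hn0
    omega
  have hbound : ∀ F : Fin (d + 1) → MvPolynomial (Fin n) ℝ, IsBlekhermanExpansion p d f F →
      ∀ e, cubeSq p (F e) ≤ (16 * (M / η)) ^ (2 * d) := by
    intro F hF e
    obtain ⟨hF1, hF2⟩ := isBlekhermanExpansion_iff.1 hF
    have h := cubeSq_le_of_isSystem hp hp1 hd hk hM
      (fun e => harmonicSub_mono (Nat.sub_le _ _) (hF1 e)) (A := 1) (fun i => by
        rw [one_mul]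
        refine le_of_eq_of_le ?_ (sum_slice_le_of_sliceNorm_le_one (hk.le_n i) (hfk i))
        exact Finset.sum_congr rfl fun x _ => by rw [hF2]) e
    rwa [mul_one] at h
  have hex := existsUnique_isBlekhermanExpansion (injective_expansionMap hp hp1 hd hk hM) hf hfd
  refine ⟨?_, hex, fun F hF e => ?_⟩
  · obtain ⟨F, hF, -⟩ := hex
    rw [one_mul]
    exact cubeNorm_le_of_cubeSq_le (by positivity)
      (cubeSq_le_pow hn hn0 hp hp1 hR hF (hbound F hF))
  · refine (cubeNorm_le_of_cubeSq_le (by positivity) (hbound F hF e)).trans ?_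
    gcongr
    norm_num
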